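/- Consider a cell-free downlink with $B$ base stations (BSs) with $M$ antennas each and $K$ users (UEs) with $N$ antennas each. The UEs are partitioned into $G$ non-empty multicast groups $\mathcal K_1,\dots,\mathcal K_G$, and $g_k$ is the group of UE $k$. Let $\mathbf H_{b,k}\in\mathbb C^{M\times N}$ be fixed channel matrices, $\mathbf H_k=[\mathbf H_{1,k}^{\mathrm T},\dots,\mathbf H_{B,k}^{\mathrm T}]^{\mathrm T}\in\mathbb C^{BM\times N}$, and let $\sigma>0$. For precoders $\mathbf w_g=[\mathbf w_{1,g}^{\mathrm T},\dots,\mathbf w_{B,g}^{\mathrm T}]^{\mathrm T}$ with $\mathbf w_{b,g}\in\mathbb C^M$, and combiners $\mathbf v_k\in\mathbb C^N$, put $$\mathrm{MSE}_k=\sum_{g}|\mathbf v_k^{\mathrm H}\mathbf H_k^{\mathrm H}\mathbf w_g|^2-2\Re[\mathbf v_k^{\mathrm H}\mathbf H_k^{\mathrm H}\mathbf w_{g_k}]+\sigma^2\|\mathbf v_k\|^2+1,$$ $$\gamma_k=\frac{|\mathbf v_k^{\mathrm H}\mathbf H_k^{\mathrm H}\mathbf w_{g_k}|^2}{\sum_{g\neq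 g_k}|\mathbf v_k^{\mathrm H}\mathbf H_k^{\mathrm H}\mathbf w_g|^2+\sigma^2\|\mathbf v_k\|^2}\quad(\gamma_k=0\text{ if }\mathbf v_k=\mathbf 0),\qquad R_k=\log_2(1+\gamma_k).$$ For $\rho>0$ consider the following two problems, each over all $(\{\mathbf w_g\},\{\mathbf v_k\})$ with $\sum_g\|\mathbf w_{b,g}\|^2\le\rho$ for every $b$: (i) the sum MSE minimization, minimize $\sum_{k}\mathrm{MSE}_k$; (ii) the sum-group MSE minimization, minimize $\sum_{g}\max_{k\in\mathcal K_g}\mathrm{MSE}_k$. Assume that the system is not overloaded: there are combiners $\{\mathbf v_k\}$ such that, for every $k$, the effective uplink channel $\mathbf H_k\mathbf v_k$ does not lie in the linear span of the effective uplink channels $\mathbf H_j\mathbf v_j$ of the UEs $j\notin\mathcal K_{g_k}$. Then both problems have a (global) solution for every $\rho>0$. If $R_k^{\text{S-MSE}}(\rho)$ and $R_k^{\text{SG-MSE}}(\rho)$ are the rates of UE $k$ at any solution of (i) and any solution of (ii), respectively, then for every $k$, as $\rho\to\infty$, $$R_k^{\text{S-MSE}}(\rho)\to\infty\qquad\text{and}\qquad\frac{\bigl|R_k^{\text{S-MSE}}(\rho)-R_k^{\text{SG-MSE}}(\rho)\bigr|}{R_k^{\text{S-MSE}}(\rho)}\to0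 .$$ -/

import Mathlib

open Filter Topology

noncomputable section

namespace Multicast

/-- A joint design: the BS-specific precoders `w g b` (precoder of BS `b` for group `g`, a vector of
`ℂ^M`), together with the combiners `v k` of the UEs (vectors of `ℂ^N`). -/
abbrev Design (B M N K G : ℕ) : Type :=
  (Fin G → Fin B → EuclideanSpace ℂ (Fin M)) × (Fin K → EuclideanSpace ℂ (Fin N))

/-- The scalar `v_kᴴ H_kᴴ w_g = ∑_b v_kᴴ H_{b,k}ᴴ w_{b,g}`: the gain with which the stream of group `g`
appears at the output of the combiner of UE `k`. -/
def gain {B M N K G : ℕ} (H : Fin B → Fin K → Matrix (Fin M) (Fin N) ℂ)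
    (x : Design B M N K G) (k : Fin K) (g : Fin G) : ℂ :=
  ∑ b, star (x.2 k).ofLp ⬝ᵥ ((H b k).conjTranspose.mulVec (x.1 g b).ofLp)

/-- The mean squared error of UE `k`, for unit-power uncorrelated data symbols and independent white
noise of variance `σ ^ 2` per receive antenna. -/
def mse {B M N K G : ℕ} (H : Fin B → Fin K → Matrix (Fin M) (Fin N) ℂ) (grp : Fin K → Fin G)
    (σ : ℝ) (x : Design B M N K G) (k : Fin K) : ℝ :=
  ∑ g, ‖gain H x k g‖ ^ 2 - 2 * (gain H x k (grp k)).re + σ ^ 2 * ‖x.2 k‖ ^ 2 + 1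

/-- The signal-to-interference-plus-noise ratio of UE `k` (zero if its combiner is zero). -/
def sinr {B M N K G : ℕ} (H : Fin B → Fin K → Matrix (Fin M) (Fin N) ℂ) (grp : Fin K → Fin G)
    (σ : ℝ) (x : Design B M N K G) (k : Fin K) : ℝ :=
  ‖gain H x k (grp k)‖ ^ 2 /
    (∑ g ∈ Finset.univ.filter (fun g => g ≠ grp k), ‖gain H x k g‖ ^ 2 + σ ^ 2 * ‖x.2 k‖ ^ 2)

/-- The rate `log₂ (1 + SINR_k)` of UE `k`. -/
def rate {B M N K G : ℕ} (H : Fin B → Fin K → Matrix (Fin M) (Fin N) ℂ) (grp : Fin K → Fin G)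
    (σ : ℝ) (x : Design B M N K G) (k : Fin K) : ℝ :=
  Real.logb 2 (1 + sinr H grp σ x k)

/-- The designs that meet the per-BS transmit power constraints `∑_g ‖w_{b,g}‖² ≤ ρ` for every BS `b`. -/
def feasible (B M N K G : ℕ) (ρ : ℝ) : Set (Design B M N K G) :=
  {x | ∀ b, ∑ g, ‖x.1 g b‖ ^ 2 ≤ ρ}

/-- The weighted sum MSE objective `∑_k ω_k MSE_k`. -/
def weightedSumMSE {B M N K G : ℕ} (H : Fin B → Fin K → Matrix (Fin M) (Fin N) ℂ)
    (grp : Fin K → Fin G) (σ : ℝ) (ω : Fin K → ℝ) (x : Design B M N K G) : ℝ :=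
  ∑ k, ω k * mse H grp σ x k

/-- The sum-group MSE objective `∑_g max_{k ∈ K_g} MSE_k` (the groups are finite; the supremum is a
maximum as soon as they are non-empty). -/
def sumGroupMSE {B M N K G : ℕ} (H : Fin B → Fin K → Matrix (Fin M) (Fin N) ℂ)
    (grp : Fin K → Fin G) (σ : ℝ) (x : Design B M N K G) : ℝ :=
  ∑ g, ⨆ k : {k : Fin K // grp k = g}, mse H grp σ x k.1

/-- `x` solves (globally, jointly in precoders and combiners) the sum MSE minimization, i.e. the
weighted sum MSE minimization with all weights equal to one, under per-BS power budget `ρ`. -/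
def SolvesSumMSE {B M N K G : ℕ} (H : Fin B → Fin K → Matrix (Fin M) (Fin N) ℂ)
    (grp : Fin K → Fin G) (σ ρ : ℝ) (x : Design B M N K G) : Prop :=
  x ∈ feasible B M N K G ρ ∧
    IsMinOn (weightedSumMSE H grp σ (fun _ => 1)) (feasible B M N K G ρ) x

/-- `x` solves (globally, jointly in precoders and combiners) the sum-group MSE minimization under
per-BS power budget `ρ`. -/
def SolvesSumGroupMSE {B M N K G : ℕ} (H : Fin B → Fin K → Matrix (Fin M) (Fin N) ℂ)
    (grp : Fin K → Fin G) (σ ρ : ℝ) (x : Design B M N K G) : Prop :=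
  x ∈ feasible B M N K G ρ ∧ IsMinOn (sumGroupMSE H grp σ) (feasible B M N K G ρ) x

/-- The effective uplink channel `H_k v_k ∈ ℂ^{BM}` of UE `k`, by blocks of length `M`. -/
def effectiveChannel {B M N K : ℕ} (H : Fin B → Fin K → Matrix (Fin M) (Fin N) ℂ)
    (v : Fin K → EuclideanSpace ℂ (Fin N)) (k : Fin K) : Fin B → Fin M → ℂ :=
  fun b => (H b k).mulVec (v k).ofLp

/-- The channels are not overloaded: for some choice of combiners, no UE has its effective uplink
channel in the span of the effective uplink channels of the UEs outside its multicast group. -/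
def NotOverloaded {B M N K G : ℕ} (H : Fin B → Fin K → Matrix (Fin M) (Fin N) ℂ)
    (grp : Fin K → Fin G) : Prop :=
  ∃ v : Fin K → EuclideanSpace ℂ (Fin N), ∀ k,
    effectiveChannel H v k ∉
      Submodule.span ℂ (effectiveChannel H v '' {j | grp j ≠ grp k})

end Multicast

end

namespace Multicast

variable {B M N K G : ℕ} {H : Fin B → Fin K → Matrix (Fin M) (Fin N) ℂ} {grp : Fin K → Fin G}
  {σ : ℝ}

/-! Under both criteria every rate is `log₂ ρ + O(1)`, so the difference stays bounded while the
rate diverges. The power budget and the noise give `SINR ≤ D ρ` (`sinr_le`). Conversely, scaling a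
zero-forcing design makes the sum MSE `O(1 / ρ)` (`exists_feasible_sumMSE_le`). Since each `MSE_k`
is at most the sum-group MSE, itself at most the sum MSE, every solution of either problem has
`MSE_k ≤ C / ρ`, and `one_le_mse_mul` turns this into `1 + SINR_k ≥ ρ / C`. -/

/-- Completing the square isolates the SINR denominator inside the MSE. -/
lemma mse_eq_add_interference (x : Design B M N K G) (k : Fin K) :
    mse H grp σ x k = ‖1 - gain H x k (grp k)‖ ^ 2 +
      (∑ g ∈ Finset.univ.filter (fun g => g ≠ grp k), ‖gain H x k g‖ ^ 2
        + σ ^ 2 * ‖x.2 k‖ ^ 2) := by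
  have h1 : ∑ g, ‖gain H x k g‖ ^ 2 = ‖gain H x k (grp k)‖ ^ 2 +
      ∑ g ∈ Finset.univ.filter (fun g => g ≠ grp k), ‖gain H x k g‖ ^ 2 := by
    rw [Finset.filter_ne',
      Finset.add_sum_erase _ (fun g => ‖gain H x k g‖ ^ 2) (Finset.mem_univ _)]
  have h2 : ‖1 - gain H x k (grp k)‖ ^ 2 =
      1 - 2 * (gain H x k (grp k)).re + ‖gain H x k (grp k)‖ ^ 2 := by
    rw [← Complex.normSq_eq_norm_sq, ← Complex.normSq_eq_norm_sq, Complex.normSq_apply,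
      Complex.normSq_apply]
    simp
    ring
  rw [mse, h1, h2]
  ring

lemma sum_interference_nonneg (x : Design B M N K G) (k : Fin K) :
    0 ≤ ∑ g ∈ Finset.univ.filter (fun g => g ≠ grp k), ‖gain H x k g‖ ^ 2 :=
  Finset.sum_nonneg fun _ _ => sq_nonneg _

lemma noise_le_mse (x : Design B M N K G) (k : Fin K) :
    σ ^ 2 * ‖x.2 k‖ ^ 2 ≤ mse H grp σ x k := by
  rw [mse_eq_add_interference]
  have := sum_interference_nonneg (H := H) (grp := grp) x k
  have := sq_nonneg ‖1 - gain H x k (grp k)‖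
  linarith

lemma mse_nonneg (x : Design B M N K G) (k : Fin K) : 0 ≤ mse H grp σ x k :=
  le_trans (by positivity) (noise_le_mse x k)

lemma sinr_nonneg (x : Design B M N K G) (k : Fin K) : 0 ≤ sinr H grp σ x k := by
  unfold sinr
  positivity

lemma gain_eq_zero_of_combiner_eq_zero {x : Design B M N K G} {k : Fin K} (h : x.2 k = 0)
    (g : Fin G) : gain H x k g = 0 := by
  simp [gain, h]

/-- No combiner achieves a mean squared error below `1 / (1 + SINR)`. -/
lemma one_le_mse_mul (hσ : 0 < σ) (x : Design B M N K G) (k : Fin K) :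
    1 ≤ mse H grp σ x k * (1 + sinr H grp σ x k) := by
  by_cases hv : x.2 k = 0
  -- Here the MSE is 1 and the SINR is `0 / 0 = 0`.
  · have h := fun g => gain_eq_zero_of_combiner_eq_zero (H := H) hv g
    simp [mse, sinr, h, hv]
  · rw [mse_eq_add_interference, sinr]
    set a := gain H x k (grp k)
    have hS := sum_interference_nonneg (H := H) (grp := grp) x k
    set I := ∑ g ∈ Finset.univ.filter (fun g => g ≠ grp k), ‖gain H x k g‖ ^ 2
        + σ ^ 2 * ‖x.2 k‖ ^ 2
    have hI : 0 < I := by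
      have := norm_pos_iff.2 hv
      have : 0 < σ ^ 2 * ‖x.2 k‖ ^ 2 := by positivity
      linarith
    have htri : 1 ≤ ‖1 - a‖ + ‖a‖ := by
      simpa using norm_add_le (1 - a) a
    have hsq : 1 ≤ (‖1 - a‖ + ‖a‖) ^ 2 := one_le_pow₀ htri
    -- Cauchy–Schwarz; the two sides differ by `(‖1 - a‖ * ‖a‖ - I) ^ 2`.
    have hcs : I * (‖1 - a‖ + ‖a‖) ^ 2 ≤ (‖1 - a‖ ^ 2 + I) * (I + ‖a‖ ^ 2) := by
      nlinarith [sq_nonneg (‖1 - a‖ * ‖a‖ - I)]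
    have hmul : I * 1 ≤ I * (‖1 - a‖ + ‖a‖) ^ 2 := mul_le_mul_of_nonneg_left hsq hI.le
    rw [show (‖1 - a‖ ^ 2 + I) * (1 + ‖a‖ ^ 2 / I) =
      (‖1 - a‖ ^ 2 + I) * (I + ‖a‖ ^ 2) / I by field_simp, le_div_iff₀ hI]
    linarith

lemma norm_dotProduct_mulVec_le {m n : ℕ} (A : Matrix (Fin n) (Fin m) ℂ)
    (v : EuclideanSpace ℂ (Fin n)) (w : EuclideanSpace ℂ (Fin m)) :
    ‖star v.ofLp ⬝ᵥ A.mulVec w.ofLp‖ ≤ (∑ i, ∑ j, ‖A i j‖) * ‖v‖ * ‖w‖ := by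
  simp only [dotProduct, Matrix.mulVec, Finset.mul_sum, Finset.sum_mul]
  refine (norm_sum_le _ _).trans (Finset.sum_le_sum fun i _ => ?_)
  refine (norm_sum_le _ _).trans (Finset.sum_le_sum fun j _ => ?_)
  rw [norm_mul, norm_mul, Pi.star_apply, norm_star]
  calc ‖v.ofLp i‖ * (‖A i j‖ * ‖w.ofLp j‖) ≤ ‖v‖ * (‖A i j‖ * ‖w‖) := by
        gcongr
        · exact PiLp.norm_apply_le v i
        · exact PiLp.norm_apply_le w j
    _ = ‖A i j‖ * ‖v‖ * ‖w‖ := by ring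

lemma norm_precoder_le {ρ : ℝ} {x : Design B M N K G} (hx : x ∈ feasible B M N K G ρ)
    (g : Fin G) (b : Fin B) : ‖x.1 g b‖ ≤ √ρ := by
  refine Real.le_sqrt_of_sq_le (le_trans ?_ (hx b))
  exact Finset.single_le_sum (f := fun g => ‖x.1 g b‖ ^ 2) (fun _ _ => sq_nonneg _)
    (Finset.mem_univ g)

lemma norm_gain_le {ρ : ℝ} {x : Design B M N K G} (hx : x ∈ feasible B M N K G ρ)
    (k : Fin K) (g : Fin G) :
    ‖gain H x k g‖ ≤ (∑ b, ∑ i, ∑ j, ‖(H b k).conjTranspose i j‖) * ‖x.2 k‖ * √ρ := by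
  rw [gain, Finset.sum_mul, Finset.sum_mul]
  refine (norm_sum_le _ _).trans (Finset.sum_le_sum fun b _ => ?_)
  refine (norm_dotProduct_mulVec_le _ _ _).trans ?_
  gcongr
  exact norm_precoder_le hx g b

/-- With the interference dropped, `‖v_k‖²` cancels, so the bound is uniform in the combiners. -/
lemma sinr_le (hσ : 0 < σ) {ρ : ℝ} (hρ : 0 ≤ ρ) {x : Design B M N K G}
    (hx : x ∈ feasible B M N K G ρ) (k : Fin K) :
    sinr H grp σ x k ≤
      (∑ b, ∑ i, ∑ j, ‖(H b k).conjTranspose i j‖) ^ 2 / σ ^ 2 * ρ := by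
  set D := ∑ b, ∑ i, ∑ j, ‖(H b k).conjTranspose i j‖
  by_cases hv : x.2 k = 0
  · have h := fun g => gain_eq_zero_of_combiner_eq_zero (H := H) hv g
    simp only [sinr, h]
    simp
    positivity
  · have hpos := norm_pos_iff.2 hv
    have hS := sum_interference_nonneg (H := H) (grp := grp) x k
    have hn : 0 < σ ^ 2 * ‖x.2 k‖ ^ 2 := by positivity
    have hg : ‖gain H x k (grp k)‖ ^ 2 ≤ D ^ 2 * ‖x.2 k‖ ^ 2 * ρ := by
      calc _ ≤ (D * ‖x.2 k‖ * √ρ) ^ 2 := by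
            gcongr
            exact norm_gain_le hx k _
        _ = _ := by rw [mul_pow, mul_pow, Real.sq_sqrt hρ]
    rw [sinr]
    calc _ ≤ (D ^ 2 * ‖x.2 k‖ ^ 2 * ρ) / (σ ^ 2 * ‖x.2 k‖ ^ 2) := by
          gcongr
          linarith
      _ = _ := by field_simp

/-! ### Existence of minimizers -/

lemma continuous_gain (k : Fin K) (g : Fin G) :
    Continuous fun x : Design B M N K G => gain H x k g := by
  simp only [gain, dotProduct, Matrix.mulVec, Pi.star_apply]
  fun_prop

lemma continuous_mse (k : Fin K) : Continuous fun x : Design B M N K G => mse H grp σ x k := by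
  have := fun g : Fin G => continuous_gain (H := H) k g
  unfold mse
  fun_prop

lemma continuous_weightedSumMSE (ω : Fin K → ℝ) :
    Continuous (weightedSumMSE H grp σ ω : Design B M N K G → ℝ) := by
  have := fun k => continuous_mse (H := H) (grp := grp) (σ := σ) k
  unfold weightedSumMSE
  fun_prop

lemma continuous_sumGroupMSE (hgrp : Function.Surjective grp) :
    Continuous (sumGroupMSE H grp σ : Design B M N K G → ℝ) := by
  unfold sumGroupMSE
  refine continuous_finsetSum _ fun g _ => ?_
  have : Nonempty {k : Fin K // grp k = g} := let ⟨k, hk⟩ := hgrp g; ⟨⟨k, hk⟩⟩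
  simp_rw [← Finset.sup'_univ_eq_ciSup]
  exact Continuous.finset_sup'_apply _ fun k _ => continuous_mse _

lemma mse_le_sumGroupMSE (x : Design B M N K G) (k : Fin K) :
    mse H grp σ x k ≤ sumGroupMSE H grp σ x := by
  calc mse H grp σ x k ≤ ⨆ j : {j : Fin K // grp j = grp k}, mse H grp σ x j.1 :=
        le_ciSup (f := fun j : {j : Fin K // grp j = grp k} => mse H grp σ x j.1)
          (Set.finite_range _).bddAbove ⟨k, rfl⟩
    _ ≤ _ := Finset.single_le_sum
        (f := fun g => ⨆ j : {j : Fin K // grp j = g}, mse H grp σ x j.1)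
        (fun _ _ => Real.iSup_nonneg fun _ => mse_nonneg x _) (Finset.mem_univ _)

lemma mse_le_sumMSE (x : Design B M N K G) (k : Fin K) :
    mse H grp σ x k ≤ weightedSumMSE H grp σ (fun _ => 1) x := by
  simp only [weightedSumMSE, one_mul]
  exact Finset.single_le_sum (f := mse H grp σ x) (fun _ _ => mse_nonneg x _) (Finset.mem_univ _)

/-- The maximum of nonnegative numbers is at most their sum. One benchmark design thus serves both
problems. -/
lemma sumGroupMSE_le_sumMSE (x : Design B M N K G) :
    sumGroupMSE H grp σ x ≤ weightedSumMSE H grp σ (fun _ => 1) x := by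
  simp only [weightedSumMSE, one_mul]
  rw [← Finset.sum_fiberwise Finset.univ grp]
  refine Finset.sum_le_sum fun g _ => ?_
  refine Real.iSup_le (fun j => ?_) (Finset.sum_nonneg fun _ _ => mse_nonneg x _)
  exact Finset.single_le_sum (f := mse H grp σ x) (fun _ _ => mse_nonneg x _)
    (by simp [j.2])

lemma isClosed_feasible (ρ : ℝ) : IsClosed (feasible B M N K G ρ) := by
  simp only [feasible, Set.ofPred_forall]
  exact isClosed_iInter fun b => isClosed_le (by fun_prop) continuous_const

/-- A continuous objective dominating every mean squared error has a minimizer among the feasible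
designs. -/
lemma exists_isMinOn_feasible (hσ : 0 < σ) {ρ : ℝ} (hρ : 0 ≤ ρ) {f : Design B M N K G → ℝ}
    (hf : Continuous f) (hmse : ∀ x k, mse H grp σ x k ≤ f x) :
    ∃ x ∈ feasible B M N K G ρ, IsMinOn f (feasible B M N K G ρ) x := by
  have h0 : (0 : Design B M N K G) ∈ feasible B M N K G ρ := fun b => by simpa using hρ
  -- The constraints leave the combiners free; on a sublevel set the noise term bounds them.
  have hbdd : Bornology.IsBounded (feasible B M N K G ρ ∩ {x | f x ≤ f 0}) := by
    refine isBounded_iff_forall_norm_le.2 ⟨max (√ρ) (√(f 0 / σ ^ 2)), ?_⟩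
    rintro x ⟨hx, hfx⟩
    refine (Prod.norm_def x).le.trans (max_le_max ?_ ?_)
    · exact (pi_norm_le_iff_of_nonneg (Real.sqrt_nonneg _)).2 fun g =>
        (pi_norm_le_iff_of_nonneg (Real.sqrt_nonneg _)).2 fun b => norm_precoder_le hx g b
    · refine (pi_norm_le_iff_of_nonneg (Real.sqrt_nonneg _)).2 fun k => ?_
      refine Real.le_sqrt_of_sq_le ((le_div_iff₀ (by positivity)).2 ?_)
      rw [mul_comm]
      exact (noise_le_mse x k).trans ((hmse x k).trans hfx)
  have hcpt := Metric.isCompact_of_isClosed_isBounded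
    ((isClosed_feasible ρ).inter (isClosed_le hf continuous_const)) hbdd
  obtain ⟨x, hx, hmin⟩ := hcpt.exists_isMinOn ⟨0, h0, le_refl (f 0)⟩ hf.continuousOn
  refine ⟨x, hx.1, fun y hy => ?_⟩
  rcases le_total (f y) (f 0) with h | h
  · exact hmin ⟨hy, h⟩
  · exact le_trans hx.2 h

/-! ### Zero forcing -/

/-- A linear functional that vanishes on the effective channels of all other groups, and on none of
the effective channels of the group `g`. -/
lemma exists_dual_zeroForcing {v : Fin K → EuclideanSpace ℂ (Fin N)}
    (hv : ∀ k, effectiveChannel H v k ∉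
      Submodule.span ℂ (effectiveChannel H v '' {j | grp j ≠ grp k})) (g : Fin G) :
    ∃ φ : Module.Dual ℂ (Fin B → Fin M → ℂ),
      ∀ k, φ (effectiveChannel H v k) = 0 ↔ grp k ≠ g := by
  let p : Submodule ℂ (Module.Dual ℂ (Fin B → Fin M → ℂ)) :=
    (Submodule.span ℂ (effectiveChannel H v '' {j | grp j ≠ g})).dualAnnihilator
  -- Each user of the group has its own functional in `p` that is nonzero on its channel; one
  -- element of `p` then works for these finitely many users at once.
  obtain ⟨φ, hφp, hφ⟩ := Module.Dual.exists_forall_mem_ne_zero_of_forall_exists p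
    (fun k : {k : Fin K // grp k = g} => Module.Dual.eval ℂ _ (effectiveChannel H v k.1)) (by
      rintro ⟨k, rfl⟩
      obtain ⟨f, hf, hle⟩ := Submodule.exists_le_ker_of_notMem (hv k)
      exact ⟨f, (Submodule.mem_dualAnnihilator f).2 fun w hw => hle hw, hf⟩)
  refine ⟨φ, fun k => ⟨fun h hk => hφ ⟨k, hk⟩ h, fun hk => ?_⟩⟩
  exact (Submodule.mem_dualAnnihilator φ).1 hφp _ (Submodule.subset_span ⟨k, hk, rfl⟩)

/-- The precoder that represents a linear functional on the effective channels. -/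
def dualPrecoder (φ : Module.Dual ℂ (Fin B → Fin M → ℂ)) (b : Fin B) :
    EuclideanSpace ℂ (Fin M) :=
  WithLp.toLp 2 fun m => star (φ (Pi.single b (Pi.single m 1)))

lemma gain_dualPrecoder (φ : Fin G → Module.Dual ℂ (Fin B → Fin M → ℂ))
    (v : Fin K → EuclideanSpace ℂ (Fin N)) (k : Fin K) (g : Fin G) :
    gain H (fun g => dualPrecoder (φ g), v) k g = star (φ g (effectiveChannel H v k)) := by
  have hφ : φ g (effectiveChannel H v k) = ∑ b, ∑ m,
      effectiveChannel H v k b m * φ g (Pi.single b (Pi.single m 1)) := by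
    have h : effectiveChannel H v k = ∑ b, ∑ m,
        effectiveChannel H v k b m • Pi.single b (Pi.single m (1 : ℂ)) := by
      ext b m
      simp [Finset.sum_apply, Pi.single_apply, apply_ite, ite_apply]
    conv_lhs => rw [h]
    simp
  rw [hφ, gain, star_sum]
  refine Finset.sum_congr rfl fun b _ => ?_
  rw [Matrix.dotProduct_mulVec, ← Matrix.star_mulVec, star_sum]
  simp [dotProduct, dualPrecoder, effectiveChannel]

lemma gain_smul_combiner (w : Fin G → Fin B → EuclideanSpace ℂ (Fin M))
    (v : Fin K → EuclideanSpace ℂ (Fin N)) (c : Fin K → ℂ) (k : Fin K) (g : Fin G) :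
    gain H (w, fun k => c k • v k) k g = star (c k) * gain H (w, v) k g := by
  simp [gain, Finset.mul_sum, smul_dotProduct]

lemma gain_smul_precoder (w : Fin G → Fin B → EuclideanSpace ℂ (Fin M))
    (v : Fin K → EuclideanSpace ℂ (Fin N)) (c : ℂ) (k : Fin K) (g : Fin G) :
    gain H (fun g b => c • w g b, v) k g = c * gain H (w, v) k g := by
  simp [gain, Finset.mul_sum, Matrix.mulVec_smul, dotProduct_smul]

/-- Some design removes all interference and has unit gain for every user. -/
lemma exists_zeroForcing (hH : NotOverloaded H grp) :
    ∃ x : Design B M N K G, ∀ k g, gain H x k g = if g = grp k then 1 else 0 := by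
  obtain ⟨v, hv⟩ := hH
  choose φ hφ using exists_dual_zeroForcing hv
  -- Members of a group share a precoder but may see different gains; each normalizes its own by its
  -- combiner.
  refine ⟨(fun g => dualPrecoder (φ g),
    fun k => (φ (grp k) (effectiveChannel H v k))⁻¹ • v k), fun k g => ?_⟩
  rw [gain_smul_combiner, gain_dualPrecoder, ← star_mul']
  split_ifs with h
  · subst h
    have : φ (grp k) (effectiveChannel H v k) ≠ 0 := fun h => (hφ _ k).1 h rfl
    rw [inv_mul_cancel₀ this, star_one]
  · rw [(hφ g k).2 (Ne.symm h), mul_zero, star_zero]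

/-- The optimal sum mean squared error decays at least as fast as the inverse of the power. -/
lemma exists_feasible_sumMSE_le (hH : NotOverloaded H grp) (σ : ℝ) :
    ∃ C : ℝ, 0 < C ∧ ∀ ρ : ℝ, 0 < ρ → ∃ x ∈ feasible B M N K G ρ,
      weightedSumMSE H grp σ (fun _ => 1) x ≤ C / ρ := by
  obtain ⟨⟨w, v⟩, hx⟩ := exists_zeroForcing hH
  -- The `+ 1` keeps `P` positive even when all precoders vanish.
  set P : ℝ := ∑ b, ∑ g, ‖w g b‖ ^ 2 + 1
  have hP0 : 0 ≤ ∑ b, ∑ g, ‖w g b‖ ^ 2 := by positivity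
  have hP : 0 < P := by positivity
  refine ⟨P * (σ ^ 2 * ∑ k, ‖v k‖ ^ 2) + 1, by positivity, fun ρ hρ => ?_⟩
  set s : ℝ := √(ρ / P)
  have hs : 0 < s := Real.sqrt_pos.2 (by positivity)
  have hs2 : s ^ 2 = ρ / P := Real.sq_sqrt (by positivity)
  -- The opposite scalings preserve all gains, so only noise remains, shrunk by `s⁻² = P / ρ`.
  refine ⟨(fun g b => (s : ℂ) • w g b, fun k => (s : ℂ)⁻¹ • v k), fun b => ?_, ?_⟩
  · simp only [norm_smul, Complex.norm_real, mul_pow, Real.norm_eq_abs, sq_abs,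
      ← Finset.mul_sum]
    have hle : ∑ g, ‖w g b‖ ^ 2 ≤ P := by
      have := Finset.single_le_sum (f := fun b => ∑ g, ‖w g b‖ ^ 2)
        (fun _ _ => by positivity) (Finset.mem_univ b)
      linarith
    calc s ^ 2 * ∑ g, ‖w g b‖ ^ 2 ≤ s ^ 2 * P := by gcongr
      _ = ρ := by rw [hs2]; field_simp
  · have hsC : (s : ℂ) ≠ 0 := by exact_mod_cast hs.ne'
    have hmse : ∀ k, mse H grp σ
        (fun g b => (s : ℂ) • w g b, fun k => (s : ℂ)⁻¹ • v k) k =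
          P / ρ * (σ ^ 2 * ‖v k‖ ^ 2) := by
      intro k
      have hgain : ∀ g, gain H (fun g b => (s : ℂ) • w g b, fun k => (s : ℂ)⁻¹ • v k) k g =
          if g = grp k then 1 else 0 := by
        intro g
        rw [gain_smul_precoder, gain_smul_combiner, hx, ← mul_assoc]
        simp [hsC]
      rw [mse_eq_add_interference, hgain, Finset.sum_eq_zero]
      · simp only [if_true, sub_self, norm_smul, norm_inv, Complex.norm_real,
          Real.norm_eq_abs, mul_pow, inv_pow, sq_abs, hs2]
        field_simp
        simp
      · intro g hg
        rw [hgain, if_neg (Finset.mem_filter.1 hg).2]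
        simp
    simp only [weightedSumMSE, one_mul, hmse]
    rw [← Finset.mul_sum, ← Finset.mul_sum, div_mul_eq_mul_div]
    gcongr
    linarith

/-! ### Rate asymptotics -/

/-- A family of feasible designs whose mean squared errors decay like the inverse of the power has
rates `log₂ ρ + O(1)`. -/
lemma exists_abs_rate_sub_logb_le (hσ : 0 < σ) {C : ℝ} (hC : 0 < C)
    (k : Fin K) : ∃ c : ℝ, ∀ ρ : ℝ, 1 ≤ ρ → ∀ x ∈ feasible B M N K G ρ,
      mse H grp σ x k ≤ C / ρ → |rate H grp σ x k - Real.logb 2 ρ| ≤ c := by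
  set D : ℝ := (∑ b, ∑ i, ∑ j, ‖(H b k).conjTranspose i j‖) ^ 2 / σ ^ 2
  have hD : 0 ≤ D := by positivity
  refine ⟨max (Real.logb 2 (1 + D)) (Real.logb 2 C), fun ρ hρ x hx hmse => ?_⟩
  have hρ0 : 0 < ρ := by linarith
  have hγ0 := sinr_nonneg (H := H) (grp := grp) (σ := σ) x k
  -- `ρ ≥ 1` absorbs the summand 1.
  have hup : 1 + sinr H grp σ x k ≤ (1 + D) * ρ := by
    have := sinr_le (H := H) (grp := grp) hσ hρ0.le hx k
    nlinarith
  have hlow : ρ ≤ C * (1 + sinr H grp σ x k) := by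
    have h1 := one_le_mse_mul (H := H) (grp := grp) hσ x k
    have h2 : 1 ≤ C / ρ * (1 + sinr H grp σ x k) :=
      h1.trans (mul_le_mul_of_nonneg_right hmse (by linarith))
    rwa [div_mul_eq_mul_div, le_div_iff₀ hρ0, one_mul] at h2
  have hup' := Real.logb_le_logb_of_le one_lt_two (by linarith) hup
  have hlow' := Real.logb_le_logb_of_le one_lt_two hρ0 hlow
  rw [Real.logb_mul (by positivity) hρ0.ne'] at hup'
  rw [Real.logb_mul hC.ne' (by positivity)] at hlow'
  rw [rate, abs_le]
  have := le_max_left (Real.logb 2 (1 + D)) (Real.logb 2 C)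
  have := le_max_right (Real.logb 2 (1 + D)) (Real.logb 2 C)
  constructor <;> linarith

end Multicast

theorem proposition1 {B M N K G : ℕ}
    (H : Fin B → Fin K → Matrix (Fin M) (Fin N) ℂ)
    (grp : Fin K → Fin G) (hgrp : Function.Surjective grp)
    (σ : ℝ) (hσ : 0 < σ)
    (hH : Multicast.NotOverloaded H grp) :
    (∀ ρ : ℝ, 0 < ρ →
      (∃ x, Multicast.SolvesSumMSE H grp σ ρ x) ∧
      (∃ x, Multicast.SolvesSumGroupMSE H grp σ ρ x)) ∧
    ∀ xS xSG : ℝ → Multicast.Design B M N K G,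
      (∀ ρ : ℝ, 0 < ρ → Multicast.SolvesSumMSE H grp σ ρ (xS ρ)) →
      (∀ ρ : ℝ, 0 < ρ → Multicast.SolvesSumGroupMSE H grp σ ρ (xSG ρ)) →
      ∀ k : Fin K,
        Tendsto (fun ρ => Multicast.rate H grp σ (xS ρ) k) atTop atTop ∧
        Tendsto (fun ρ =>
          |Multicast.rate H grp σ (xS ρ) k - Multicast.rate H grp σ (xSG ρ) k| /
            Multicast.rate H grp σ (xS ρ) k) atTop (𝓝 0) := by
  open Multicast in
  refine ⟨fun ρ hρ => ⟨?_, ?_⟩, fun xS xSG hS hSG k => ?_⟩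
  · exact exists_isMinOn_feasible hσ hρ.le (continuous_weightedSumMSE _) mse_le_sumMSE
  · exact exists_isMinOn_feasible hσ hρ.le (continuous_sumGroupMSE hgrp) mse_le_sumGroupMSE
  obtain ⟨C, hC, hopt⟩ := exists_feasible_sumMSE_le hH σ
  obtain ⟨c, hc⟩ := exists_abs_rate_sub_logb_le (H := H) (grp := grp) hσ hC k
  have hrS : ∀ ρ, 1 ≤ ρ → |rate H grp σ (xS ρ) k - Real.logb 2 ρ| ≤ c := by
    intro ρ hρ
    obtain ⟨y, hy, hyC⟩ := hopt ρ (by linarith)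
    obtain ⟨hx, hmin⟩ := hS ρ (by linarith)
    exact hc ρ hρ _ hx ((mse_le_sumMSE _ k).trans ((hmin hy).trans hyC))
  have hrSG : ∀ ρ, 1 ≤ ρ → |rate H grp σ (xSG ρ) k - Real.logb 2 ρ| ≤ c := by
    intro ρ hρ
    obtain ⟨y, hy, hyC⟩ := hopt ρ (by linarith)
    obtain ⟨hx, hmin⟩ := hSG ρ (by linarith)
    exact hc ρ hρ _ hx ((mse_le_sumGroupMSE _ k).trans
      ((hmin hy).trans ((sumGroupMSE_le_sumMSE y).trans hyC)))
  have htop : Tendsto (fun ρ => rate H grp σ (xS ρ) k) atTop atTop := by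
    refine tendsto_atTop_mono' atTop ?_
      (tendsto_atTop_add_const_right atTop (-c) (Real.tendsto_logb_atTop one_lt_two))
    filter_upwards [eventually_ge_atTop 1] with ρ hρ
    have := (abs_le.1 (hrS ρ hρ)).1
    linarith
  -- Both rates lie within `c` of `log₂ ρ`, hence within `2 * c` of each other.
  refine ⟨htop, squeeze_zero' ?_ ?_ (htop.const_div_atTop (2 * c))⟩
  · filter_upwards [htop.eventually_ge_atTop 0] with ρ h
    positivity
  · filter_upwards [htop.eventually_ge_atTop 0, eventually_ge_atTop 1] with ρ h hρ
    gcongr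
    have h1 := abs_le.1 (hrS ρ hρ)
    have h2 := abs_le.1 (hrSG ρ hρ)
    exact abs_le.2 ⟨by linarith, by linarith⟩
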